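/- All graphs are finite, undirected, simple and connected. A graph is *edge-regular* with parameters $(n,k,\lambda)$ if it has $n$ vertices, is $k$-regular, and any two adjacent vertices have exactly $\lambda$ common neighbours. A nonempty clique $C$ is a *regular clique* if there is an integer $a$ such that every vertex outside $C$ has exactly $a$ neighbours in $C$. A *Neumaier graph* is a non-complete edge-regular graph that contains a regular clique. A *strongly regular graph* with parameters $(n,k,\lambda,\mu)$ is a non-complete connected $k$-regular graph with $n$ vertices in which any two adjacent vertices have exactly $\lambda$ common neighbours and any two distinct non-adjacent vertices have exactly $\mu$ common neighbours; it is *nontrivial* if $0<\mu<k$. A *circulant graph* is a graph isomorphic to a Cayley graph $\mathrm{Cay}(\mathbb{Z}_n,S)$ with $n\ge 1$, where $S\subseteq\mathbb{Z}_n\setminus\{0\}$ satisfies $S=-S$, and $x,y\in\mathbb{Z}_n$ are adjacent if and only if $x-y\in S$. **Proposition.** There is no nontrivial strongly regular Neumaier circulant graph; that is, no graph is at the same time a nontrivial strongly regular graph, a Neumaier graph and a circulant graph. -/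

import Mathlib

namespace NeumaierCirculant

/-- Edge-regular with parameters `(n, k, l)`: `n` vertices, `k`-regular, and any two adjacent
vertices have exactly `l` common neighbours. -/
structure IsEdgeRegularWith {V : Type*} [Fintype V] (G : SimpleGraph V) [DecidableRel G.Adj]
    (n k l : ℕ) : Prop where
  card : Fintype.card V = n
  regular : G.IsRegularOfDegree k
  of_adj : ∀ v w, G.Adj v w → Fintype.card (G.commonNeighbors v w) = l

/-- `C` is a (nonempty) regular clique with nexus `a`: it is a clique, and every vertex outside `C`
has exactly `a` neighbours in `C`. In a connected non-complete graph this forces `1 ≤ a`. -/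
structure IsRegularClique {V : Type*} (G : SimpleGraph V) [DecidableRel G.Adj]
    (C : Finset V) (a : ℕ) : Prop where
  nonempty : C.Nonempty
  isClique : G.IsClique (C : Set V)
  nexus : ∀ v, v ∉ C → (C.filter (fun w => G.Adj v w)).card = a

/-- A Neumaier graph: a connected non-complete edge-regular graph with a regular clique. -/
structure IsNeumaier {V : Type*} [Fintype V] (G : SimpleGraph V) [DecidableRel G.Adj] :
    Prop where
  connected : G.Connected
  not_complete : G ≠ ⊤
  edgeRegular : ∃ n k l : ℕ, IsEdgeRegularWith G n k l
  regularClique : ∃ (C : Finset V) (a : ℕ), IsRegularClique G C a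

/-- A strongly regular graph with parameters `(n, k, l, m)`, in the sense that also demands that
the graph be connected and not complete. -/
structure IsStronglyRegular {V : Type*} [Fintype V] (G : SimpleGraph V) [DecidableRel G.Adj]
    (n k l m : ℕ) : Prop where
  connected : G.Connected
  not_complete : G ≠ ⊤
  srg : G.IsSRGWith n k l m

/-- A nontrivial strongly regular graph: strongly regular with parameters `(n, k, l, m)` such that
`0 < m < k`. -/
def IsNontrivialStronglyRegular {V : Type*} [Fintype V] (G : SimpleGraph V)
    [DecidableRel G.Adj] : Prop :=
  ∃ n k l m : ℕ, IsStronglyRegular G n k l m ∧ 0 < m ∧ m < k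

/-- A (finite) circulant graph: a graph isomorphic to a Cayley graph over the cyclic group
`ZMod n`, `n ≥ 1`, whose connection set `S` is inverse-closed and does not contain the identity. -/
def IsCirculant {V : Type*} (G : SimpleGraph V) : Prop :=
  ∃ (n : ℕ) (S : Set (ZMod n)), 0 < n ∧ (0 : ZMod n) ∉ S ∧ (∀ s ∈ S, -s ∈ S) ∧
    Nonempty (G ≃g SimpleGraph.circulantGraph S)

end NeumaierCirculant

/-! The connection set `S` of a strongly regular circulant is a partial difference set in a cyclic
group, and such a set is trivial unless the order is prime (`card_prime`). For a prime `p` dividing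
the order, the `p`-th power of `S` in the group ring over `ZMod p` is the sum of the `p • s`, yet
also a combination of `1`, `S` and the whole group. Elements outside the image of `p` force the
coefficients of the last two to vanish, so off the `p`-torsion `S` is a union of torsion cosets. If
the order is not `p`, the torsion itself is then handled by counting mod `p`, and `S` is trivial.
With `n` prime, counting the edges leaving a clique of size `c` and nexus `a` gives `n * a = c * (k
+ 1 - c + a)`. Then `n` divides a factor, which forces completeness. -/

/-- `S` is a regular partial difference set with parameters `(k, l, m)`: a symmetric subset of size
`k` that avoids `0`, such that a nonzero `x` is a sum of two elements of `S` in exactly `l` ways if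
`x ∈ S`, and in exactly `m` ways otherwise. -/
structure IsPartialDifferenceSet {A : Type*} [AddCommGroup A] [DecidableEq A] (S : Finset A)
    (k l m : ℕ) : Prop where
  zero_notMem : (0 : A) ∉ S
  neg_mem : ∀ s ∈ S, -s ∈ S
  card_eq : S.card = k
  of_mem : ∀ x ∈ S, (S.filter (fun s => x - s ∈ S)).card = l
  of_notMem : ∀ x ∉ S, x ≠ 0 → (S.filter (fun s => x - s ∈ S)).card = m

/-! ### Counting in partial difference sets. -/

namespace IsPartialDifferenceSet

variable {A : Type*} [AddCommGroup A] [DecidableEq A] {S : Finset A} {k l m : ℕ}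

theorem neg_mem_iff (h : IsPartialDifferenceSet S k l m) {x : A} : -x ∈ S ↔ x ∈ S :=
  ⟨fun hx => by simpa using h.neg_mem _ hx, h.neg_mem x⟩

theorem sub_mem_comm (h : IsPartialDifferenceSet S k l m) {x y : A} : x - y ∈ S ↔ y - x ∈ S := by
  rw [← h.neg_mem_iff, neg_sub]

theorem ne_zero_of_mem (h : IsPartialDifferenceSet S k l m) {x : A} (hx : x ∈ S) : x ≠ 0 :=
  fun h0 => h.zero_notMem (h0 ▸ hx)

theorem exists_add_eq (h : IsPartialDifferenceSet S k l m) (hm : 0 < m) {x : A} (hx : x ∉ S)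
    (hx0 : x ≠ 0) : ∃ s ∈ S, x - s ∈ S := by
  have := h.of_notMem x hx hx0
  obtain ⟨s, hs⟩ := Finset.card_pos.1 (this ▸ hm)
  exact ⟨s, (Finset.mem_filter.1 hs).1, (Finset.mem_filter.1 hs).2⟩

/-- A nonzero non-element cannot leave the set invariant, since `m < k`. -/
theorem exists_sub_notMem (h : IsPartialDifferenceSet S k l m) (hmk : m < k) {x : A} (hx : x ∉ S)
    (hx0 : x ≠ 0) : ∃ s ∈ S, x - s ∉ S := by
  by_contra! hall
  have := h.of_notMem x hx hx0
  rw [Finset.filter_true_of_mem hall, h.card_eq] at this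
  omega

theorem eq_top_of_subset (h : IsPartialDifferenceSet S k l m) (hm : 0 < m) (H : AddSubgroup A)
    (hS : ∀ x ∈ S, x ∈ H) : H = ⊤ := by
  rw [eq_top_iff]
  rintro x -
  by_cases hx : x ∈ S
  · exact hS x hx
  by_cases hx0 : x = 0
  · exact hx0 ▸ H.zero_mem
  obtain ⟨s, hs, hs'⟩ := h.exists_add_eq hm hx hx0
  simpa using H.add_mem (hS _ hs') (hS _ hs)

/-- The number of ways to write `x` as a sum of two elements of the complement. -/
theorem card_compl_filter [Fintype A] (h : IsPartialDifferenceSet S k l m) (x : A) :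
    (Sᶜ.filter (fun s => x - s ∉ S)).card + 2 * k =
      Fintype.card A + (S.filter (fun s => x - s ∈ S)).card := by
  -- Inclusion–exclusion for `S` and `x - S`, both of size `k`.
  have h1 : (S.filter (fun s => x - s ∈ S)).card + (S.filter (fun s => x - s ∉ S)).card = k := by
    rw [Finset.card_filter_add_card_filter_not, h.card_eq]
  have h2 : (Finset.univ.filter (fun s => x - s ∈ S)).card = k := by
    rw [← h.card_eq]
    refine Finset.card_bij' (fun s _ => x - s) (fun s _ => x - s) ?_ ?_ ?_ ?_ <;> simp
  have h3 : (Sᶜ.filter (fun s => x - s ∉ S)).card + (S.filter (fun s => x - s ∉ S)).card +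
      (Finset.univ.filter (fun s => x - s ∈ S)).card = Fintype.card A := by
    rw [← Finset.card_union_of_disjoint, ← Finset.filter_union, Finset.union_comm,
      Finset.union_compl, add_comm, Finset.card_filter_add_card_filter_not, Finset.card_univ]
    exact Finset.disjoint_filter_filter disjoint_compl_left
  omega

/-- An element outside `H` is in `S` and is not a sum of two non-elements. The number of such sums
is the same for all of `S`, hence zero, so subtracting a non-element maps `S` into itself; for a
nonzero one this contradicts `m < k`. -/
theorem eq_top_of_compl_subset [Fintype A] (h : IsPartialDifferenceSet S k l m) (hmk : m < k)
    (hT : ∃ t ∉ S, t ≠ 0) (H : AddSubgroup A) (hH : ∀ x ∉ S, x ∈ H) : H = ⊤ := by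
  by_contra hne
  obtain ⟨x, hx⟩ : ∃ x, x ∉ H := by
    by_contra! hall
    exact hne (eq_top_iff.2 fun x _ => hall x)
  have hxS : x ∈ S := by_contra fun hxS => hx (hH x hxS)
  have key : ∀ y ∈ S, ∀ z ∉ S, y - z ∈ S := by
    have hx0 : (Sᶜ.filter (fun s => x - s ∉ S)).card = 0 := by
      rw [Finset.card_eq_zero, Finset.filter_eq_empty_iff]
      intro z hz hxz
      apply hx
      simpa using H.add_mem (hH _ hxz) (hH z (Finset.mem_compl.1 hz))
    intro y hy z hz
    by_contra hyz
    have h1 := h.card_compl_filter x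
    have h2 := h.card_compl_filter y
    rw [h.of_mem x hxS] at h1
    rw [h.of_mem y hy] at h2
    have : 0 < (Sᶜ.filter (fun s => y - s ∉ S)).card :=
      Finset.card_pos.2 ⟨z, by simp [hz, hyz]⟩
    omega
  obtain ⟨t, ht, ht0⟩ := hT
  obtain ⟨s, hs, hts⟩ := h.exists_sub_notMem hmk ht ht0
  exact hts (h.sub_mem_comm.1 (key s hs t ht))

/-! ### Frobenius in the modular group ring. -/

section FrobeniusFibres

open AddMonoidAlgebra

variable [Fintype A]

/-- The powers of a partial difference set in the group ring are constant on the set, and on the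
set of its nonzero non-elements. -/
theorem exists_pow_eq {R : Type*} [CommRing R] (h : IsPartialDifferenceSet S k l m) (j : ℕ) :
    ∃ a b c : R, (∑ s ∈ S, single s (1 : R) : AddMonoidAlgebra R A) ^ j =
      a • 1 + b • (∑ s ∈ S, single s (1 : R)) + c • (∑ s : A, single s (1 : R)) := by
  set f : AddMonoidAlgebra R A := ∑ s ∈ S, single s (1 : R) with hf
  set J : AddMonoidAlgebra R A := ∑ s : A, single s (1 : R) with hJ
  have cf : ∀ x, f.coeff x = if x ∈ S then 1 else 0 := by
    intro x
    simp [hf, coeff_sum, Finsupp.finsetSum_apply, Finsupp.single_apply]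
  have cJ : ∀ x, J.coeff x = 1 := by
    intro x
    simp [hJ, coeff_sum, Finsupp.finsetSum_apply, Finsupp.single_apply]
  have c1 : ∀ x, (1 : AddMonoidAlgebra R A).coeff x = if x = 0 then 1 else 0 := by
    intro x
    simp [one_def, Finsupp.single_apply, eq_comm]
  have hJf : J * f = (k : R) • J := by
    ext x
    rw [hf, Finset.mul_sum, coeff_sum, Finsupp.finsetSum_apply]
    simp [cJ, h.card_eq]
  have hff : f * f = ((k : R) - m) • 1 + ((l : R) - m) • f + (m : R) • J := by
    ext x
    conv_lhs => rw [hf, Finset.mul_sum, coeff_sum, Finsupp.finsetSum_apply, ← hf]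
    have : ∀ s ∈ S, (f * single s (1 : R)).coeff x = if x - s ∈ S then 1 else 0 := by
      intro s _
      rw [coeff_mul_single_apply, cf, mul_one, sub_eq_add_neg]
    rw [Finset.sum_congr rfl this, ← Finset.natCast_card_filter]
    simp only [coeff_add, coeff_smul, Finsupp.add_apply, Finsupp.smul_apply, c1, cf, cJ,
      smul_eq_mul]
    by_cases hx0 : x = 0
    · have : S.filter (fun s => x - s ∈ S) = S := by
        rw [Finset.filter_true_of_mem]
        intro s hs
        simpa [hx0] using h.neg_mem s hs
      rw [this, h.card_eq, if_pos hx0, if_neg (hx0 ▸ h.zero_notMem)]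
      ring
    · by_cases hx : x ∈ S
      · rw [h.of_mem x hx, if_neg hx0, if_pos hx]
        ring
      · rw [h.of_notMem x hx hx0, if_neg hx0, if_neg hx]
        ring
  induction j with
  | zero => exact ⟨1, 0, 0, by simp⟩
  | succ j ih =>
    obtain ⟨a, b, c, habc⟩ := ih
    refine ⟨b * (k - m), a + b * (l - m), b * m + c * k, ?_⟩
    rw [pow_succ, habc, add_mul, add_mul, smul_mul_assoc, smul_mul_assoc, smul_mul_assoc, one_mul,
      hff, hJf]
    module

/-- If neither the set nor its complement lies in the image of multiplication by the prime `p`,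
then `p` divides the size of each of the nonzero fibres of multiplication by `p` on the set. -/
theorem dvd_card_nsmul_fibre (h : IsPartialDifferenceSet S k l m) {p : ℕ} (hp : p.Prime)
    (hS : ∃ x ∈ S, ∀ y, p • y ≠ x) (hT : ∃ x ∉ S, ∀ y, p • y ≠ x) {g : A} (hg : g ≠ 0) :
    p ∣ (S.filter (fun s => p • s = g)).card := by
  have := Fact.mk hp
  have : CharP (AddMonoidAlgebra (ZMod p) A) p :=
    charP_of_injective_algebraMap (algebraMap (ZMod p) (AddMonoidAlgebra (ZMod p) A)).injective p
  obtain ⟨a, b, c, habc⟩ := h.exists_pow_eq (R := ZMod p) p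
  -- Frobenius turns the coefficient of the `p`-th power at `x` into the size of the fibre over `x`.
  rw [sum_pow_char] at habc
  have key : ∀ x : A, x ≠ 0 → ((S.filter (fun s => p • s = x)).card : ZMod p) =
      b * (if x ∈ S then 1 else 0) + c := by
    intro x hx
    have := congrArg (fun f => f.coeff x) habc
    simpa [coeff_sum, Finsupp.finsetSum_apply, Finsupp.single_apply, single_pow, one_def,
      hx.symm] using this
  obtain ⟨x, hx, hxp⟩ := hS
  obtain ⟨y, hy, hyp⟩ := hT
  have hx' := key x (h.ne_zero_of_mem hx)
  have hy' := key y (fun h0 => hyp 0 (by simp [h0]))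
  -- Both fibres are empty, so `b + c = 0` and `c = 0`.
  rw [Finset.filter_false_of_mem (fun s _ => hxp s), if_pos hx] at hx'
  rw [Finset.filter_false_of_mem (fun s _ => hyp s), if_neg hy] at hy'
  have hc : c = 0 := by simpa using hy'.symm
  have hb : b = 0 := by simpa [hc] using hx'.symm
  rw [← ZMod.natCast_eq_zero_iff, key g hg, hb, hc]
  simp

end FrobeniusFibres

/-! ### Cosets of the `p`-torsion in a cyclic group. -/

section PrimeTorsion

variable [Fintype A] [IsAddCyclic A] {p : ℕ}

theorem _root_.IsAddCyclic.card_filter_nsmul_eq_zero (hp : p.Prime) (hpA : p ∣ Fintype.card A) :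
    (Finset.univ.filter (fun x : A => p • x = 0)).card = p := by
  have := Fact.mk hp
  apply le_antisymm (IsAddCyclic.card_nsmul_eq_zero_le hp.pos)
  obtain ⟨u, hu⟩ := exists_prime_addOrderOf_dvd_card p hpA
  calc p = ((Finset.range p).image (fun i => i • u)).card := by
        rw [Finset.card_image_of_injOn, Finset.card_range]
        intro i hi j hj hij
        exact nsmul_injOn_Iio_addOrderOf (by simpa [hu] using hi) (by simpa [hu] using hj) hij
    _ ≤ _ := by
        apply Finset.card_le_card
        intro x hx
        obtain ⟨i, -, rfl⟩ := Finset.mem_image.1 hx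
        simp only [Finset.mem_filter, Finset.mem_univ, true_and]
        rw [nsmul_left_comm, ← hu, addOrderOf_nsmul_eq_zero, nsmul_zero]

theorem _root_.IsAddCyclic.card_filter_nsmul_eq_nsmul (hp : p.Prime) (hpA : p ∣ Fintype.card A)
    (x : A) : (Finset.univ.filter (fun y : A => p • y = p • x)).card = p := by
  conv_rhs => rw [← IsAddCyclic.card_filter_nsmul_eq_zero (A := A) hp hpA]
  refine Finset.card_bij' (fun y _ => y - x) (fun y _ => y + x) ?_ ?_ ?_ ?_ <;>
    simp +contextual [nsmul_sub]

/-- A set invariant under translation by the `p`-torsion has size divisible by `p`. -/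
theorem _root_.IsAddCyclic.dvd_card_of_nsmul_invariant (hp : p.Prime) (hpA : p ∣ Fintype.card A)
    (W : Finset A) (hW : ∀ x ∈ W, ∀ y, p • y = p • x → y ∈ W) : p ∣ W.card := by
  rw [Finset.card_eq_sum_card_image (fun x => p • x) W]
  refine Finset.dvd_sum fun z hz => ?_
  obtain ⟨x, hx, rfl⟩ := Finset.mem_image.1 hz
  have : W.filter (fun y => p • y = p • x) = Finset.univ.filter (fun y : A => p • y = p • x) := by
    ext y
    simp only [Finset.mem_filter, Finset.mem_univ, true_and, and_iff_right_iff_imp]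
    exact hW x hx y
  rw [this, IsAddCyclic.card_filter_nsmul_eq_nsmul hp hpA]

/-- Outside of the `p`-torsion, a nontrivial partial difference set is a union of cosets of the
`p`-torsion. -/
theorem mem_of_nsmul_eq (h : IsPartialDifferenceSet S k l m) (hm : 0 < m) (hmk : m < k)
    (hT : ∃ t ∉ S, t ≠ 0) (hp : p.Prime) (hpA : p ∣ Fintype.card A) {x y : A} (hx : x ∈ S)
    (hx0 : p • x ≠ 0) (hxy : p • y = p • x) : y ∈ S := by
  have hrange : (nsmulAddMonoidHom p : A →+ A).range ≠ ⊤ := by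
    intro htop
    have hinj : Function.Injective (nsmulAddMonoidHom p : A →+ A) :=
      Finite.injective_iff_surjective.2 (AddMonoidHom.range_eq_top.1 htop)
    have h1 : (Finset.univ.filter (fun x : A => p • x = 0)).card ≤ 1 := by
      rw [Finset.card_le_one]
      intro a ha b hb
      exact hinj (((Finset.mem_filter.1 ha).2).trans ((Finset.mem_filter.1 hb).2).symm)
    rw [IsAddCyclic.card_filter_nsmul_eq_zero hp hpA] at h1
    exact absurd hp.one_lt (by omega)
  have hS' : ∃ x ∈ S, ∀ y, p • y ≠ x := by
    by_contra! hall
    exact hrange (h.eq_top_of_subset hm _ fun x hx => hall x hx)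
  have hT' : ∃ x ∉ S, ∀ y, p • y ≠ x := by
    by_contra! hall
    exact hrange (h.eq_top_of_compl_subset hmk hT _ fun x hx => hall x hx)
  have hdvd := h.dvd_card_nsmul_fibre hp hS' hT' hx0
  have hle : p ≤ (S.filter (fun s => p • s = p • x)).card :=
    Nat.le_of_dvd (Finset.card_pos.2 ⟨x, by simp [hx]⟩) hdvd
  -- The full fibre has only `p` elements, so `S` fills it.
  have heq : S.filter (fun s => p • s = p • x) =
      Finset.univ.filter (fun s : A => p • s = p • x) := by
    apply Finset.eq_of_subset_of_card_le (Finset.filter_subset_filter _ (Finset.subset_univ _))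
    rwa [IsAddCyclic.card_filter_nsmul_eq_nsmul hp hpA]
  have hy : y ∈ S.filter (fun s => p • s = p • x) := by simp [heq, hxy]
  exact (Finset.mem_filter.1 hy).1

/-- Two torsion elements of a nontrivial partial difference set never add up to a nonzero
non-element. -/
theorem add_mem_of_nsmul_eq_zero (h : IsPartialDifferenceSet S k l m) (hm : 0 < m) (hmk : m < k)
    (hT : ∃ t ∉ S, t ≠ 0) (hp : p.Prime) (hpA : p ∣ Fintype.card A) (hpA' : p ≠ Fintype.card A)
    {a b : A} (ha : a ∈ S) (hb : b ∈ S) (hpa : p • a = 0) (hpb : p • b = 0) (hab : a + b ≠ 0) :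
    a + b ∈ S := by
  by_contra habS
  have inv : ∀ x ∈ S, p • x ≠ 0 → ∀ y, p • y = p • x → y ∈ S := fun x hx hx0 y hy =>
    h.mem_of_nsmul_eq hm hmk hT hp hpA hx hx0 hy
  obtain ⟨t, htS, ht⟩ : ∃ t ∉ S, p • t ≠ 0 := by
    by_contra! hall
    have htop := h.eq_top_of_compl_subset hmk hT (nsmulAddMonoidHom p : A →+ A).ker
      fun x hx => hall x hx
    apply hpA'
    rw [← IsAddCyclic.card_filter_nsmul_eq_zero hp hpA, ← Finset.card_univ,
      Finset.filter_true_of_mem]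
    intro x _
    have : x ∈ (nsmulAddMonoidHom p : A →+ A).ker := htop ▸ AddSubgroup.mem_top x
    exact this
  -- In `t = x + (t - x)` neither term is torsion, as otherwise the other term would lie in the
  -- torsion coset of `t` and put `t` in `S`. So the representations of `t` come in full cosets.
  have hmdvd : p ∣ m := by
    rw [← h.of_notMem t htS (fun h0 => ht (by simp [h0]))]
    apply IsAddCyclic.dvd_card_of_nsmul_invariant hp hpA
    intro x hx y hyx
    obtain ⟨hxS, htx⟩ := Finset.mem_filter.1 hx
    have hx0 : p • x ≠ 0 := by
      intro hx0
      exact htS (inv (t - x) htx (by simpa [nsmul_sub, hx0] using ht) t (by simp [nsmul_sub, hx0]))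
    have htx0 : p • (t - x) ≠ 0 := by
      intro htx0
      refine htS (inv x hxS hx0 t ?_)
      rwa [nsmul_sub, sub_eq_zero] at htx0
    exact Finset.mem_filter.2 ⟨inv x hxS hx0 y hyx,
      inv _ htx htx0 _ (by rw [nsmul_sub, nsmul_sub, hyx])⟩
  have hpab : p • (a + b) = 0 := by rw [nsmul_add, hpa, hpb, add_zero]
  have hcard := h.of_notMem _ habS hab
  -- The non-torsion representations of `a + b` come in cosets, so `p` divides the number of torsion
  -- ones. That number is positive because of `a`, and below `p` because `0` is excluded.
  rw [← Finset.card_filter_add_card_filter_not (fun s => p • s = 0)] at hcard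
  have hdvd₂ : p ∣ ((S.filter (fun s => a + b - s ∈ S)).filter (fun s => ¬ p • s = 0)).card := by
    apply IsAddCyclic.dvd_card_of_nsmul_invariant hp hpA
    intro x hx y hyx
    simp only [Finset.mem_filter] at hx ⊢
    obtain ⟨⟨hxS, habx⟩, hx0⟩ := hx
    refine ⟨⟨inv x hxS hx0 y hyx, inv _ habx ?_ _ ?_⟩, hyx ▸ hx0⟩
    · rwa [nsmul_sub, hpab, zero_sub, neg_ne_zero]
    · rw [nsmul_sub, nsmul_sub, hyx]
  have hdvd₁ : p ∣ ((S.filter (fun s => a + b - s ∈ S)).filter (fun s => p • s = 0)).card := by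
    rw [← Nat.dvd_add_left hdvd₂, hcard]
    exact hmdvd
  have hlt : ((S.filter (fun s => a + b - s ∈ S)).filter (fun s => p • s = 0)).card < p := by
    conv_rhs => rw [← IsAddCyclic.card_filter_nsmul_eq_zero (A := A) hp hpA]
    apply Finset.card_lt_card
    refine ⟨fun x hx => by simp [(Finset.mem_filter.1 hx).2], fun hsub => ?_⟩
    have h0 := @hsub 0 (by simp)
    exact h.zero_notMem (Finset.mem_filter.1 (Finset.mem_filter.1 h0).1).1
  have hpos : 0 < ((S.filter (fun s => a + b - s ∈ S)).filter (fun s => p • s = 0)).card :=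
    Finset.card_pos.2 ⟨a, by simp [ha, hb, hpa]⟩
  exact absurd (Nat.le_of_dvd hpos hdvd₁) (by omega)

/-- A nontrivial partial difference set contains all or none of the nonzero `p`-torsion. -/
theorem torsion_disjoint_or_subset (h : IsPartialDifferenceSet S k l m) (hm : 0 < m) (hmk : m < k)
    (hT : ∃ t ∉ S, t ≠ 0) (hp : p.Prime) (hpA : p ∣ Fintype.card A)
    (hpA' : p ≠ Fintype.card A) :
    (∀ x, p • x = 0 → x ∉ S) ∨ (∀ x, p • x = 0 → x ≠ 0 → x ∈ S) := by
  let H : AddSubgroup A :=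
    { carrier := {x | p • x = 0 ∧ (x ≠ 0 → x ∈ S)}
      zero_mem' := by simp
      neg_mem' := by
        rintro x ⟨hx, hxS⟩
        exact ⟨by simp [hx], fun hx0 => h.neg_mem x (hxS (neg_ne_zero.1 hx0))⟩
      add_mem' := by
        rintro x y ⟨hx, hxS⟩ ⟨hy, hyS⟩
        refine ⟨by simp [hx, hy], fun hxy => ?_⟩
        by_cases hx0 : x = 0
        · simp only [hx0, zero_add] at hxy ⊢
          exact hyS hxy
        by_cases hy0 : y = 0
        · simpa [hy0] using hxS hx0
        exact h.add_mem_of_nsmul_eq_zero hm hmk hT hp hpA hpA' (hxS hx0) (hyS hy0) hx hy hxy }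
  let K : AddSubgroup A := (nsmulAddMonoidHom p : A →+ A).ker
  have hK : Nat.card K = p := by
    rw [← IsAddCyclic.card_filter_nsmul_eq_zero (A := A) hp hpA]
    exact Nat.subtype_card _ fun x => by simp [K]
  have hHK : H ≤ K := fun x hx => hx.1
  rcases (Nat.dvd_prime hp).1 (hK ▸ AddSubgroup.card_dvd_of_le hHK) with h1 | h1
  · left
    intro x hx hxS
    have hxH : x ∈ H := ⟨hx, fun _ => hxS⟩
    rw [AddSubgroup.eq_bot_of_card_eq H h1, AddSubgroup.mem_bot] at hxH
    exact h.ne_zero_of_mem hxS hxH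
  · right
    intro x hx hx0
    -- The torsion has prime order, so its subgroup `H` is trivial or everything.
    have hxH : x ∈ H := by
      rw [AddSubgroup.eq_of_le_of_card_ge hHK (by rw [hK, h1])]
      exact hx
    exact hxH.2 hx0

/-- A cyclic group containing a nontrivial partial difference set has prime order. -/
theorem card_prime (h : IsPartialDifferenceSet S k l m) (hm : 0 < m) (hmk : m < k)
    (hT : ∃ t ∉ S, t ≠ 0) : (Fintype.card A).Prime := by
  obtain ⟨t, htS, ht0⟩ := hT
  have hA : Fintype.card A ≠ 1 := fun h1 =>
    ht0 ((Fintype.card_le_one_iff.1 h1.le) t 0)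
  obtain ⟨p, hp, hpA⟩ := Nat.exists_prime_and_dvd hA
  by_contra hnp
  have hpA' : p ≠ Fintype.card A := fun hpe => hnp (hpe ▸ hp)
  have inv : ∀ x ∈ S, p • x ≠ 0 → ∀ y, p • y = p • x → y ∈ S := fun x hx hx0 y hy =>
    h.mem_of_nsmul_eq hm hmk ⟨t, htS, ht0⟩ hp hpA hx hx0 hy
  have := Fact.mk hp
  obtain ⟨u, hu⟩ := exists_prime_addOrderOf_dvd_card p hpA
  have hpu : p • u = 0 := by rw [← hu, addOrderOf_nsmul_eq_zero]
  have hu0 : u ≠ 0 := by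
    rintro rfl
    exact hp.one_lt.ne (by simpa using hu)
  rcases h.torsion_disjoint_or_subset hm hmk ⟨t, htS, ht0⟩ hp hpA hpA' with hdis | hsub
  -- Here `S` avoids the torsion, so it is invariant under translation by the non-element `u`.
  · obtain ⟨s, hs, hus⟩ := h.exists_sub_notMem hmk (hdis u hpu) hu0
    exact hus (h.sub_mem_comm.1 (inv s hs (fun h0 => hdis s h0 hs) _ (by simp [nsmul_sub, hpu])))
  · have huS := hsub u hpu hu0
    -- The value of `l` read off at `u` is maximal, so differences of distinct elements of `S` stay
    -- in `S`. Then `t = s - (s - t)` would lie in `S`.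
    have hl : l = k - 1 := by
      rw [← h.of_mem u huS, ← h.card_eq, ← Finset.card_erase_of_mem huS]
      congr 1
      ext s
      simp only [Finset.mem_filter, Finset.mem_erase]
      constructor
      · rintro ⟨hs, hus⟩
        exact ⟨fun hsu => h.zero_notMem (by simpa [hsu] using hus), hs⟩
      · rintro ⟨hsu, hs⟩
        refine ⟨hs, ?_⟩
        by_cases hps : p • s = 0
        · exact hsub _ (by simp [nsmul_sub, hpu, hps]) (sub_ne_zero.2 (Ne.symm hsu))
        · exact h.sub_mem_comm.1 (inv s hs hps _ (by simp [nsmul_sub, hpu]))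
    obtain ⟨s, hs, hts⟩ := h.exists_add_eq hm htS ht0
    have heq : S.filter (fun b => s - b ∈ S) = S.erase s := by
      apply Finset.eq_of_subset_of_card_le
      · intro b hb
        obtain ⟨hbS, hsb⟩ := Finset.mem_filter.1 hb
        exact Finset.mem_erase.2
          ⟨fun hbs => h.zero_notMem (by simpa [hbs] using hsb), hbS⟩
      · rw [h.of_mem s hs, Finset.card_erase_of_mem hs, h.card_eq, hl]
    have hmem : s - t ∈ S.erase s :=
      Finset.mem_erase.2 ⟨by simpa using ht0, h.sub_mem_comm.1 hts⟩
    rw [← heq] at hmem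
    exact htS (by simpa using (Finset.mem_filter.1 hmem).2)

end PrimeTorsion

end IsPartialDifferenceSet

/-! ### Regular cliques, and the passage from graphs to difference sets. -/

namespace SimpleGraph

variable {V : Type*} [Fintype V] {G : SimpleGraph V} [DecidableRel G.Adj]

/-- Double counting of the edges between a regular clique and its complement. -/
theorem _root_.NeumaierCirculant.IsRegularClique.card_mul_eq {C : Finset V} {a k : ℕ}
    (hC : NeumaierCirculant.IsRegularClique G C a) (hk : G.IsRegularOfDegree k) :
    C.card * (k + 1) = C.card * C.card + a * (Fintype.card V - C.card) := by
  classical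
  have h1 := Finset.sum_card_bipartiteAbove_eq_sum_card_bipartiteBelow (s := Cᶜ) (t := C) G.Adj
  have h2 : ∑ v ∈ Cᶜ, (Finset.bipartiteAbove G.Adj C v).card = a * (Fintype.card V - C.card) := by
    have : ∀ v ∈ Cᶜ, (Finset.bipartiteAbove G.Adj C v).card = a := fun v hv =>
      hC.nexus v (Finset.mem_compl.1 hv)
    rw [Finset.sum_congr rfl this]
    simp [Finset.card_compl, mul_comm]
  have h3 : ∀ w ∈ C, (Finset.bipartiteBelow G.Adj Cᶜ w).card + C.card = k + 1 := by
    intro w hw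
    have hsplit : (Finset.bipartiteBelow G.Adj Cᶜ w) ∪ C.erase w = G.neighborFinset w := by
      ext v
      simp only [Finset.mem_union, Finset.mem_bipartiteBelow, Finset.mem_compl, Finset.mem_erase,
        mem_neighborFinset]
      constructor
      · rintro (⟨-, hvw⟩ | ⟨hvw, hv⟩)
        · exact hvw.symm
        · exact hC.isClique hw hv (Ne.symm hvw)
      · intro hwv
        by_cases hv : v ∈ C
        · exact Or.inr ⟨hwv.ne', hv⟩
        · exact Or.inl ⟨hv, hwv.symm⟩
    have hdisj : Disjoint (Finset.bipartiteBelow G.Adj Cᶜ w) (C.erase w) := by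
      rw [Finset.disjoint_left]
      intro v hv hv'
      exact Finset.mem_compl.1 (Finset.mem_bipartiteBelow _ |>.1 hv).1 (Finset.mem_erase.1 hv').2
    have hcard := Finset.card_union_of_disjoint hdisj
    rw [hsplit, card_neighborFinset_eq_degree, hk w, Finset.card_erase_of_mem hw] at hcard
    have := Finset.card_pos.2 ⟨w, hw⟩
    omega
  have h4 : ∑ w ∈ C, ((Finset.bipartiteBelow G.Adj Cᶜ w).card + C.card) = C.card * (k + 1) := by
    rw [Finset.sum_congr rfl h3]
    simp
  rw [Finset.sum_add_distrib, ← h1, h2] at h4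
  simp only [Finset.sum_const, smul_eq_mul] at h4
  omega

theorem IsRegularOfDegree.eq_top_of_card_le {k : ℕ} (hk : G.IsRegularOfDegree k)
    (hV : Fintype.card V ≤ k + 1) : G = ⊤ := by
  classical
  ext v w
  refine ⟨fun h => h.ne, fun hvw => ?_⟩
  have hsub : G.neighborFinset v ⊆ Finset.univ.erase v := fun x hx =>
    Finset.mem_erase.2 ⟨((mem_neighborFinset _ _ _).1 hx).ne', Finset.mem_univ _⟩
  have heq := Finset.eq_of_subset_of_card_le hsub (by
    rw [card_neighborFinset_eq_degree, hk v, Finset.card_erase_of_mem (Finset.mem_univ v),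
      Finset.card_univ]
    omega)
  rw [← mem_neighborFinset, heq]
  exact Finset.mem_erase.2 ⟨Ne.symm hvw, Finset.mem_univ _⟩

/-- A regular graph on a prime number of vertices with a regular clique is complete, if any two
distinct nonadjacent vertices have a common neighbour. -/
theorem eq_top_of_isRegularClique_of_prime {C : Finset V} {a k : ℕ}
    (hC : NeumaierCirculant.IsRegularClique G C a) (hk : G.IsRegularOfDegree k)
    (hV : (Fintype.card V).Prime)
    (hcn : ∀ v w, v ≠ w → ¬ G.Adj v w → ∃ z, G.Adj v z ∧ G.Adj w z) : G = ⊤ := by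
  classical
  by_cases hCV : C = Finset.univ
  · ext v w
    exact ⟨fun h => h.ne, fun h => hC.isClique (by simp [hCV]) (by simp [hCV]) h⟩
  obtain ⟨y, hy⟩ : ∃ y, y ∉ C := by simpa [Finset.eq_univ_iff_forall] using hCV
  have hlt : C.card < Fintype.card V := Finset.card_lt_univ_of_notMem hy
  have haC : a ≤ C.card := hC.nexus y hy ▸ Finset.card_filter_le _ _
  -- With nexus zero no edge leaves `C`, so `y` and a vertex of `C` have no common neighbour.
  have ha : a ≠ 0 := by
    intro ha
    obtain ⟨c, hc⟩ := hC.nonempty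
    have hno : ∀ v ∉ C, ∀ w ∈ C, ¬ G.Adj v w := by
      intro v hv w hw hvw
      have := hC.nexus v hv
      rw [ha, Finset.card_eq_zero, Finset.filter_eq_empty_iff] at this
      exact this hw hvw
    obtain ⟨z, hyz, hcz⟩ := hcn y c (fun h => hy (h ▸ hc)) (hno y hy c hc)
    by_cases hz : z ∈ C
    · exact hno y hy z hz hyz
    · exact hno z hz c hc hcz.symm
  have hmul := hC.card_mul_eq hk
  have hpos := Finset.card_pos.2 hC.nonempty
  have hCk : C.card ≤ k + 1 := by
    by_contra hlt'
    have := Nat.mul_lt_mul_of_pos_left (not_le.1 hlt') hpos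
    omega
  have hdvd : Fintype.card V ∣ C.card * (k + 1 - C.card + a) := by
    refine ⟨a, ?_⟩
    zify [hlt.le, hCk] at hmul ⊢
    linarith
  -- The first factor is positive and below the prime. The second is positive and at most `k + 1`,
  -- as `a ≤ C.card`.
  rcases hV.dvd_mul.1 hdvd with h | h
  · exact absurd (Nat.le_of_dvd hpos h) (by omega)
  · exact hk.eq_top_of_card_le ((Nat.le_of_dvd (by omega) h).trans (by omega))

/-- The connection set of a strongly regular Cayley graph is a partial difference set. -/
theorem IsSRGWith.isPartialDifferenceSet {A : Type*} [AddCommGroup A] [DecidableEq A]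
    {S : Finset A} {n k l m : ℕ} (h : G.IsSRGWith n k l m) (e : G ≃g circulantGraph (S : Set A))
    (h0 : (0 : A) ∉ S) (hneg : ∀ s ∈ S, -s ∈ S) : IsPartialDifferenceSet S k l m := by
  classical
  have hadj : ∀ x y : A, G.Adj (e.symm x) (e.symm y) ↔ x - y ∈ S := by
    intro x y
    rw [e.symm.map_adj_iff, circulantGraph_adj]
    constructor
    · rintro ⟨-, hxy | hyx⟩
      · exact hxy
      · simpa using hneg _ hyx
    · intro hxy
      exact ⟨fun hxy' => h0 (by simpa [hxy'] using hxy), Or.inl hxy⟩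
  have hadj0 : ∀ x : A, G.Adj (e.symm 0) (e.symm x) ↔ x ∈ S := by
    intro x
    rw [adj_comm, hadj, sub_zero]
  have hcn : ∀ x : A, (S.filter (fun s => x - s ∈ S)).card =
      Fintype.card (G.commonNeighbors (e.symm 0) (e.symm x)) := by
    intro x
    rw [← Set.toFinset_card, ← Finset.card_image_of_injective _ e.symm.injective]
    congr 1
    ext v
    obtain ⟨y, rfl⟩ := e.symm.surjective v
    simp [mem_commonNeighbors, hadj0, hadj]
  refine ⟨h0, hneg, ?_, ?_, ?_⟩
  · rw [← h.regular (e.symm 0), ← card_neighborFinset_eq_degree,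
      ← Finset.card_image_of_injective _ e.symm.injective]
    congr 1
    ext v
    obtain ⟨y, rfl⟩ := e.symm.surjective v
    simp [hadj0]
  · intro x hx
    rw [hcn, h.of_adj _ _ ((hadj0 x).2 hx)]
  · intro x hx hx0
    rw [hcn]
    exact h.of_not_adj (e.symm.injective.ne (Ne.symm hx0)) (fun hx' => hx ((hadj0 x).1 hx'))

end SimpleGraph

theorem mainTheorem6 {V : Type*} [Fintype V] (G : SimpleGraph V) [DecidableRel G.Adj] :
    ¬ (NeumaierCirculant.IsNontrivialStronglyRegular G ∧ NeumaierCirculant.IsNeumaier G ∧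
      NeumaierCirculant.IsCirculant G) := by
  classical
  rintro ⟨⟨_, k, l, m, hsr, hm, hmk⟩, hN, n, S, hn, h0, hneg, ⟨e⟩⟩
  have : NeZero n := ⟨hn.ne'⟩
  obtain ⟨C, a, hC⟩ := hN.regularClique
  obtain ⟨S, rfl⟩ : ∃ S' : Finset (ZMod n), (S' : Set (ZMod n)) = S := ⟨S.toFinset, by simp⟩
  have hS := hsr.srg.isPartialDifferenceSet e h0 hneg
  have hcard : Fintype.card V = Fintype.card (ZMod n) := Fintype.card_congr e.toEquiv
  -- Otherwise `S` together with `0` is the whole group and the graph is complete.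
  have hT : ∃ t ∉ S, t ≠ 0 := by
    by_contra! hall
    refine hsr.not_complete (hsr.srg.regular.eq_top_of_card_le ?_)
    rw [hcard, ← hS.card_eq, ← Finset.card_univ, ← Finset.card_insert_of_notMem h0]
    apply Finset.card_le_card
    intro x _
    by_cases hx : x ∈ S
    · exact Finset.mem_insert_of_mem hx
    · exact hall x hx ▸ Finset.mem_insert_self _ _
  refine hsr.not_complete (SimpleGraph.eq_top_of_isRegularClique_of_prime hC hsr.srg.regular
    (hcard ▸ hS.card_prime hm hmk hT) fun v w hvw hadj => ?_)
  obtain ⟨z, hz⟩ := Fintype.card_pos_iff.1 ((hsr.srg.of_not_adj hvw hadj).symm ▸ hm)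
  exact ⟨z, hz.1, hz.2⟩
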